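/- \textbf{Model.} Let $T, M$ be positive integers and let $p_1<p_2$ be two prices in $[0,1]$. For each $k\in\{1,2\}$ let the demand at price $p_k$ have a distribution on $[0,1]$ with mean $\mu_k$, unknown to the seller. At each time step $t=1,\dots,T$ the seller offers a price $p_{i_t}$, $i_t\in\{1,2\}$; then a demand $D_t(p_{i_t})\in[0,1]$ is drawn from the distribution belonging to that price, independently of the past given $i_t$. Under a price protection guarantee of length $M$, the customers of step $t$ finally pay the lowest price offered in the steps $t,t+1,\dots,\min\{t+M,T\}$. The instantaneous refund triggered at step $t$ is $$\mathrm{Refund}_t=\sum_{s=\max\{1,t-M\}}^{t-1}\Big[\min_{s\le w\le t-1}p_{i_w}-p_{i_t}\Big]^+D_s(p_{i_s}),$$ and the total revenue is $$\mathrm{Revenue}=\sum_{t=1}^{T}\min\{p_{i_t},\dots,p_{i_{\min\{t+M,T\}}}\}\,D_t(p_{i_t}).$$ A (possibly randomized) non-anticipatory policy $\pi$ selects $i_t$, at each step $t$, from a probability distribution on $\{1,2\}$ that is a measurable function of the history $(i_s, D_s(p_{i_s}),\mathrm{Refund}_s)_{s=1}^{t-1}$; it may also use the known quantities $T$, $M$,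 $p_1$, $p_2$, but not the demand distributions. Its regret is $$\mathrm{Regret}(\pi)=T\max_{k\in\{1,2\}}p_k\mu_k-\mathbb E[\mathrm{Revenue}].$$ \textbf{Theorem.} There is a universal constant $c>0$ such that for all integers $T\ge M\ge 2$ and every non-anticipatory policy $\pi$ there exist prices $p_1<p_2$ in $[0,1]$ and demand distributions on $[0,1]$ for these two prices under which $$\mathrm{Regret}(\pi)\ \ge\ c\,\big(\sqrt T+\min\{M,\,T^{2/3}\}\big).$$ -/

import Mathlib

noncomputable section

open MeasureTheory ProbabilityTheory

open scoped unitInterval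

namespace PriceProtection

/-- The public course of the first `n` time steps, numbered `0, …, n - 1`: at each step the index of
the price offered and the realized demand in `[0, 1]`. -/
abbrev History (K n : ℕ) : Type := Fin n → Fin K × I

lemma window_nonempty {n : ℕ} (s : Fin n) (m : ℕ) :
    (Finset.univ.filter fun w : Fin n => s ≤ w ∧ (w : ℕ) ≤ s + m).Nonempty :=
  ⟨s, by simp⟩

/-- The smallest price offered from step `s` through step `s + m` (or through the last step of
the history, if that comes first). -/
def lowestPrice {K n : ℕ} (p : Fin K → I) (h : History K n) (s : Fin n) (m : ℕ) : ℝ :=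
  (Finset.univ.filter fun w : Fin n => s ≤ w ∧ (w : ℕ) ≤ s + m).inf' (window_nonempty s m)
    fun w => (p (h w).1 : ℝ)

/-- Total revenue under price protection of length `M`: the customers of step `t` finally pay the
lowest price of the steps `t, …, t + M` that lie in the horizon. -/
def revenue {K n : ℕ} (p : Fin K → I) (M : ℕ) (h : History K n) : ℝ :=
  ∑ t : Fin n, lowestPrice p h t M * ((h t).2 : ℝ)

/-- The refund triggered at step `t`, paid to the customers of the steps `s` with
`t - M ≤ s ≤ t - 1`, who have so far paid the lowest price of the steps `s, …, t - 1`. -/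
def refundAt {K n : ℕ} (p : Fin K → I) (M : ℕ) (h : History K n) (t : Fin n) : ℝ :=
  ∑ s : Fin n with s < t ∧ (t : ℕ) ≤ s + M,
    max (lowestPrice p h s ((t : ℕ) - 1 - s) - (p (h t).1 : ℝ)) 0 * ((h s).2 : ℝ)

/-- What the seller has seen after `n` steps: price index, demand and refund of each step. -/
def observe {K n : ℕ} (p : Fin K → I) (M : ℕ) (h : History K n) : Fin n → Fin K × I × ℝ :=
  fun t => ((h t).1, (h t).2, refundAt p M h t)

/-- A possibly randomized non-anticipatory pricing policy: the rule for step `t` maps the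
observations of the steps before `t` to a probability distribution over the `K` prices. (For
a horizon `T` only the rules with `t < T` are used.) -/
structure Policy (K : ℕ) where
  rule : ∀ t : ℕ, Kernel (Fin t → Fin K × I × ℝ) (Fin K)
  markov : ∀ t, IsMarkovKernel (rule t)

instance {K : ℕ} (π : Policy K) (t : ℕ) : IsMarkovKernel (π.rule t) := π.markov t

lemma measurable_lowestPrice {K n : ℕ} (p : Fin K → I) (s : Fin n) (m : ℕ) :
    Measurable fun h : History K n => lowestPrice p h s m := by
  have key : (fun h : History K n => lowestPrice p h s m) =
      (Finset.univ.filter fun w : Fin n => s ≤ w ∧ (w : ℕ) ≤ s + m).inf' (window_nonempty s m)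
        fun w (h : History K n) => (p (h w).1 : ℝ) := by
    funext h
    rw [Finset.inf'_apply]
    rfl
  rw [key]
  refine Finset.inf'_induction _ _ (fun f hf g hg => hf.inf hg) fun w _ => ?_
  exact (measurable_of_finite fun k : Fin K => (p k : ℝ)).comp
    (measurable_fst.comp (measurable_pi_apply w))

lemma measurable_observe {K n : ℕ} (p : Fin K → I) (M : ℕ) :
    Measurable (observe p M : History K n → _) := by
  refine measurable_pi_lambda _ fun t => ?_
  have hd : ∀ s : Fin n, Measurable fun h : History K n => (h s).2 := fun s =>
    measurable_snd.comp (measurable_pi_apply s)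
  have hi : ∀ s : Fin n, Measurable fun h : History K n => (h s).1 := fun s =>
    measurable_fst.comp (measurable_pi_apply s)
  refine (hi t).prodMk ((hd t).prodMk ?_)
  refine Finset.measurable_sum _ fun s _ => ?_
  refine (((measurable_lowestPrice p s _).sub ?_).max measurable_const).mul
    (measurable_subtype_coe.comp (hd s))
  exact (measurable_of_finite fun k : Fin K => (p k : ℝ)).comp (hi t)

/-- One time step: the policy draws a price index `k` from what has been observed, and then, given
`k`, the demand is drawn from the distribution `D k`, independently of the past. -/
def step {K : ℕ} (p : Fin K → I) (M : ℕ) (D : Fin K → ProbabilityMeasure I) (π : Policy K)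
    (n : ℕ) : Kernel (History K n) (Fin K × I) :=
  (π.rule n).comap (observe p M) (measurable_observe p M) ⊗ₖ
    Kernel.prodMkLeft (History K n) (Kernel.ofFunOfCountable fun k => (D k : Measure I))

instance {K : ℕ} (p : Fin K → I) (M : ℕ) (D : Fin K → ProbabilityMeasure I) (π : Policy K)
    (n : ℕ) : IsMarkovKernel (step p M D π n) := by
  have : IsMarkovKernel (Kernel.ofFunOfCountable fun k => (D k : Measure I)) :=
    ⟨fun k => inferInstanceAs (IsProbabilityMeasure (D k : Measure I))⟩
  unfold step
  infer_instance

/-- The law of the first `n` time steps. -/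
def law {K : ℕ} (p : Fin K → I) (M : ℕ) (D : Fin K → ProbabilityMeasure I) (π : Policy K) :
    (n : ℕ) → Measure (History K n)
  | 0 => Measure.dirac Fin.elim0
  | n + 1 => (law p M D π n ⊗ₘ step p M D π n).map
      fun x => Fin.snoc (α := fun _ => Fin K × I) x.1 x.2

lemma measurable_snoc {K n : ℕ} : Measurable fun x : History K n × (Fin K × I) =>
    (Fin.snoc (α := fun _ => Fin K × I) x.1 x.2 : History K (n + 1)) := by
  refine measurable_pi_lambda _ fun i => ?_
  refine Fin.lastCases ?_ (fun j => ?_) i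
  · simpa using measurable_snd
  · simp only [Fin.snoc_castSucc]
    exact (measurable_pi_apply j).comp measurable_fst

instance {K : ℕ} (p : Fin K → I) (M : ℕ) (D : Fin K → ProbabilityMeasure I) (π : Policy K)
    (n : ℕ) : IsProbabilityMeasure (law p M D π n) := by
  induction n with
  | zero => unfold law; infer_instance
  | succ n ih => unfold law; exact Measure.isProbabilityMeasure_map measurable_snoc.aemeasurable

lemma integrable_revenue {K : ℕ} (p : Fin K → I) (M : ℕ) (D : Fin K → ProbabilityMeasure I)
    (π : Policy K) (n : ℕ) : Integrable (revenue p M) (law p M D π n) := by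
  refine integrable_finsetSum _ fun t _ => ?_
  refine Integrable.of_bound (C := 1) ?_ (Filter.Eventually.of_forall fun h => ?_)
  · exact ((measurable_lowestPrice p t M).mul (measurable_subtype_coe.comp
      (measurable_snd.comp (measurable_pi_apply t)))).aestronglyMeasurable
  · obtain ⟨w, -, hw⟩ := Finset.exists_mem_eq_inf' (window_nonempty t M)
      fun w => (p (h w).1 : ℝ)
    have e : lowestPrice p h t M = p (h w).1 := hw
    rw [e, Real.norm_eq_abs, abs_of_nonneg (mul_nonneg (p _).2.1 (h t).2.2.1)]
    exact mul_le_one₀ (p _).2.2 (h t).2.2.1 (h t).2.2.2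

/-- The expected demand at price `k`. -/
def meanDemand {K : ℕ} (D : Fin K → ProbabilityMeasure I) (k : Fin K) : ℝ :=
  ∫ d, (d : ℝ) ∂(D k : Measure I)

/-- `T` times the largest expected reward `p k * E[D k]`, minus the expected total revenue. -/
def regret {K : ℕ} (T M : ℕ) (p : Fin K → I) (D : Fin K → ProbabilityMeasure I)
    (π : Policy K) : ℝ :=
  T * (⨆ k : Fin K, (p k : ℝ) * meanDemand D k) - ∫ h, revenue p M h ∂(law p M D π T)

end PriceProtection

end

/-!
The menu is `1 / 2 < 3 / 4`. The demand at the low price is constant, the demand at the high price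
takes the values `1 / 4` and `3 / 4`. In one environment these values are equally likely and the low
price earns more per step by `3 y / 64`; in the other one the larger value is tilted up by `y` and
the high price earns more by `3 y / 64`. Only trials of the high price tell the two apart.

Fix `m` with `m * y ^ 2 ≤ 1 / 2` and consider the event that the high price is tried fewer than `m`
times in an initial stretch. On this event the likelihood ratios for the tilts `y` and `-y` have
a product of at least `(1 - y ^ 2) ^ m ≥ 1 / 2`, and the inequality of arithmetic and geometric
means bounds the probability of the event in the first environment by twice that in the second,
plus `1 / 4` (`law_few_offers_le`). So the seller either tries the high price often in the first
environment, or rarely in the second, with probability at least `1 / 8`.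

The regret is the expectation of the gaps of the offered prices plus the refunds, as the noise in
the demands has mean zero (`pathCost`, `mul_law_le_regret`). Because all demands are at least
`1 / 4`, each high-price step followed by a low one within `M` steps costs a constant, whatever the
dependence between later prices and the refunded demand.

* With `y = T ^ (-1 / 2)` and `m = T / 4` the gaps alone cost an order of `√T` in either case
  (`exists_sqrt_le_regret`).
* With `y = T ^ (-1 / 3)` and `m = min {M, T ^ (2 / 3)} / 4`, few trials in the first half cost an
  order of `y * T = T ^ (2 / 3)` in the second environment. After many trials, a seller who never
  returns to the low price in the second half pays an order of `y * T` in the first environment;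
  one who does return has either had every early trial refunded or a full window of `M` steps
  (`min_le_card_refunded`, `exists_min_le_regret`).
-/

noncomputable section

open MeasureTheory ProbabilityTheory

open scoped unitInterval

namespace PriceProtection

variable {K : ℕ} (p : Fin K → I) (M : ℕ) (D : Fin K → ProbabilityMeasure I) (π : Policy K)

/-! ### Change of measure between demand environments -/

lemma lintegral_step (n : ℕ) (h : History K n) {f : Fin K × I → ENNReal} (hf : Measurable f) :
    ∫⁻ y, f y ∂(step p M D π n h) =
      ∫⁻ k, ∫⁻ d, f (k, d) ∂(D k : Measure I) ∂(π.rule n (observe p M h)) := by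
  have : IsMarkovKernel (Kernel.ofFunOfCountable fun k => (D k : Measure I)) :=
    ⟨fun k => inferInstanceAs (IsProbabilityMeasure (D k : Measure I))⟩
  unfold step
  rw [Kernel.lintegral_compProd _ _ _ hf]
  rfl

lemma lintegral_law_succ (n : ℕ) {f : History K (n + 1) → ENNReal} (hf : Measurable f) :
    ∫⁻ h, f h ∂(law p M D π (n + 1)) =
      ∫⁻ h, ∫⁻ y, f (Fin.snoc (α := fun _ => Fin K × I) h y) ∂(step p M D π n h)
        ∂(law p M D π n) := by
  rw [law, lintegral_map hf measurable_snoc]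
  exact Measure.lintegral_compProd (hf.comp measurable_snoc)

/-- The likelihood ratio of a history when the demand at price `k` has relative density `w k`;
the policy's own randomization cancels. -/
def likelihood (w : Fin K → I → ENNReal) {n : ℕ} (h : History K n) : ENNReal :=
  ∏ t, w (h t).1 (h t).2

lemma measurable_likelihood {w : Fin K → I → ENNReal} (hw : ∀ k, Measurable (w k)) (n : ℕ) :
    Measurable (likelihood w : History K n → ENNReal) := by
  refine Finset.measurable_prod _ fun t _ => ?_
  exact (measurable_from_prod_countable_right hw : Measurable fun y : Fin K × I => w y.1 y.2).comp
    (measurable_pi_apply t)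

/-- Change of measure between two demand environments under the same policy. -/
lemma lintegral_law_eq_likelihood {D' : Fin K → ProbabilityMeasure I} {w : Fin K → I → ENNReal}
    (hw : ∀ k, Measurable (w k))
    (hD : ∀ k, (D' k : Measure I) = (D k : Measure I).withDensity (w k)) :
    ∀ (n : ℕ) {f : History K n → ENNReal}, Measurable f →
      ∫⁻ h, f h ∂(law p M D' π n) = ∫⁻ h, likelihood w h * f h ∂(law p M D π n)
  | 0, f, hf => by simp [law, likelihood]
  | n + 1, f, hf => by
    have hW : Measurable fun y : Fin K × I => w y.1 y.2 := measurable_from_prod_countable_right hw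
    have hfs : Measurable fun x : History K n × (Fin K × I) =>
        f (Fin.snoc (α := fun _ => Fin K × I) x.1 x.2) := hf.comp measurable_snoc
    rw [lintegral_law_succ p M D' π n hf, lintegral_law_succ p M D π n
      (f := fun h => likelihood w h * f h) ((measurable_likelihood hw _).mul hf)]
    have key : ∀ h : History K n,
        ∫⁻ y, f (Fin.snoc (α := fun _ => Fin K × I) h y) ∂(step p M D' π n h) =
        ∫⁻ y, w y.1 y.2 * f (Fin.snoc (α := fun _ => Fin K × I) h y) ∂(step p M D π n h) := by
      intro h
      have hfh : Measurable fun y : Fin K × I =>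
          f (Fin.snoc (α := fun _ => Fin K × I) h y) := hfs.comp measurable_prodMk_left
      rw [lintegral_step _ _ _ _ _ _ hfh, lintegral_step _ _ _ _ _ _
        (f := fun y => w y.1 y.2 * f (Fin.snoc (α := fun _ => Fin K × I) h y)) (hW.mul hfh)]
      refine lintegral_congr fun k => ?_
      rw [hD k]
      exact lintegral_withDensity_eq_lintegral_mul _ (hw k) (hfh.comp measurable_prodMk_left)
    have hmeas : Measurable fun h : History K n =>
        ∫⁻ y, w y.1 y.2 * f (Fin.snoc (α := fun _ => Fin K × I) h y) ∂(step p M D π n h) :=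
      Measurable.lintegral_kernel_prod_right' ((hW.comp measurable_snd).mul hfs)
    simp_rw [key]
    rw [lintegral_law_eq_likelihood hw hD n hmeas]
    refine lintegral_congr fun h => ?_
    refine (lintegral_const_mul _ (hW.mul (hfs.comp measurable_prodMk_left))).symm.trans ?_
    refine lintegral_congr fun y => ?_
    simp [likelihood, Fin.prod_univ_castSucc, mul_assoc]

/-! ### Marginals and almost sure properties of the law -/

/-- The first `n` steps of a history of `n + k` steps. -/
def initial {n k : ℕ} (h : History K (n + k)) : History K n := fun t => h (Fin.castAdd k t)

lemma measurable_initial {n k : ℕ} : Measurable (initial : History K (n + k) → History K n) :=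
  measurable_pi_lambda _ fun t => measurable_pi_apply (Fin.castAdd k t)

lemma map_initial_law (n : ℕ) : ∀ k : ℕ, (law p M D π (n + k)).map initial = law p M D π n
  | 0 => by
    have : (initial : History K (n + 0) → History K n) = id := rfl
    rw [this]; exact Measure.map_id
  | k + 1 => by
    rw [← map_initial_law n k]
    have h1 : law p M D π (n + k) = (law p M D π (n + k) ⊗ₘ step p M D π (n + k)).map Prod.fst :=
      (Measure.fst_compProd _ _).symm
    conv_rhs => rw [h1]
    rw [Measure.map_map measurable_initial measurable_fst]
    refine (Measure.map_map (measurable_initial (n := n) (k := k + 1))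
      (measurable_snoc (n := n + k))).trans ?_
    congr 1
    funext x t
    exact Fin.snoc_castSucc (α := fun _ => Fin K × I) _ _ (Fin.castAdd k t)

/-- A property of the demands that is almost sure at every price holds at all steps. -/
lemma ae_law_forall {q : I → Prop} (hm : MeasurableSet {d | q d})
    (hq : ∀ k, ∀ᵐ d ∂(D k : Measure I), q d) (n : ℕ) :
    ∀ᵐ h ∂(law p M D π n), ∀ t, q (h t).2 := by
  induction n with
  | zero => exact Filter.Eventually.of_forall fun h t => t.elim0
  | succ n ih =>
    have hms : ∀ n, MeasurableSet {h : History K n | ∀ t, q (h t).2} := fun n => by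
      simp only [Set.ofPred_forall]
      exact MeasurableSet.iInter fun t =>
        (measurable_snd.comp (measurable_pi_apply t)) hm
    have : ∀ᵐ x ∂(law p M D π n ⊗ₘ step p M D π n), q x.2.2 ∧ ∀ t, q (x.1 t).2 := by
      have hm1 : MeasurableSet {x : History K n × (Fin K × I) | q x.2.2} :=
        (measurable_snd.comp measurable_snd) hm
      have hm2 : MeasurableSet {y : Fin K × I | ¬ q y.2} := (measurable_snd hm).compl
      refine Filter.Eventually.and ?_ ?_
      · refine Measure.ae_compProd_of_ae_ae hm1 (Filter.Eventually.of_forall fun h => ?_)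
        rw [ae_iff, ← lintegral_indicator_one hm2,
          lintegral_step _ _ _ _ _ _ (measurable_one.indicator hm2)]
        have : ∀ k, ∫⁻ d, {y : Fin K × I | ¬ q y.2}.indicator 1 (k, d) ∂(D k : Measure I) = 0 := by
          intro k
          exact (lintegral_indicator_one hm.compl).trans (ae_iff.1 (hq k))
        simp [this]
      · refine Measure.ae_compProd_of_ae_ae (measurable_fst (hms n)) ?_
        filter_upwards [ih] with h hh
        exact Filter.Eventually.of_forall fun _ => hh
    rw [law, ae_map_iff measurable_snoc.aemeasurable (hms _)]
    filter_upwards [this] with x hx t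
    refine Fin.lastCases ?_ (fun j => ?_) t
    · simpa using hx.1
    · simpa using hx.2 j

/-! ### Regret as an expected path cost -/

lemma meanDemand_mem (k : Fin K) : meanDemand D k ∈ Set.Icc (0 : ℝ) 1 := by
  constructor
  · exact integral_nonneg fun d => d.2.1
  · have := integral_mono_of_nonneg (μ := (D k : Measure I)) (f := fun d : I => (d : ℝ))
      (g := fun _ => (1 : ℝ)) (Filter.Eventually.of_forall fun d => d.2.1) (integrable_const _)
      (Filter.Eventually.of_forall fun d => d.2.2)
    simpa [meanDemand] using this

/-- What the step earns at the offered price, minus its conditional expectation. -/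
def noise (y : Fin K × I) : ℝ := p y.1 * ((y.2 : ℝ) - meanDemand D y.1)

lemma measurable_noise : Measurable (noise p D) := by
  have h1 := (measurable_of_finite fun k : Fin K => (p k : ℝ)).comp
    (measurable_fst : Measurable (Prod.fst : Fin K × I → _))
  have h2 := (measurable_of_finite fun k : Fin K => meanDemand D k).comp
    (measurable_fst : Measurable (Prod.fst : Fin K × I → _))
  exact h1.mul ((measurable_subtype_coe.comp measurable_snd).sub h2)

lemma norm_noise_le (y : Fin K × I) : ‖noise p D y‖ ≤ 1 := by
  have h := meanDemand_mem D y.1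
  rw [noise, norm_mul]
  refine mul_le_one₀ ?_ (norm_nonneg _) ?_
  · rw [Real.norm_eq_abs, abs_of_nonneg (p y.1).2.1]; exact (p y.1).2.2
  · rw [Real.norm_eq_abs, abs_le]
    constructor <;> linarith [y.2.2.1, y.2.2.2, h.1, h.2]

lemma integral_noise_step (n : ℕ) (h : History K n) :
    ∫ y, noise p D y ∂(step p M D π n h) = 0 := by
  have : IsMarkovKernel (Kernel.ofFunOfCountable fun k => (D k : Measure I)) :=
    ⟨fun k => inferInstanceAs (IsProbabilityMeasure (D k : Measure I))⟩
  have hi : Integrable (noise p D) (step p M D π n h) :=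
    Integrable.of_bound (measurable_noise p D).aestronglyMeasurable 1
      (Filter.Eventually.of_forall fun y => norm_noise_le p D y)
  unfold step at hi ⊢
  rw [integral_compProd hi]
  have : ∀ k : Fin K, ∫ d, noise p D (k, d) ∂(D k : Measure I) = 0 := by
    intro k
    have hd : Integrable (fun d : I => (d : ℝ)) (D k : Measure I) :=
      Integrable.of_bound measurable_subtype_coe.aestronglyMeasurable 1
        (Filter.Eventually.of_forall fun d => by
          rw [Real.norm_eq_abs, abs_of_nonneg d.2.1]; exact d.2.2)
    simp only [noise]
    rw [integral_const_mul, integral_sub hd (integrable_const _)]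
    simp [meanDemand]
  refine (integral_congr_ae (Filter.Eventually.of_forall this)).trans (by simp)

lemma integrable_sum_noise (n : ℕ) :
    Integrable (fun h : History K n => ∑ t, noise p D (h t)) (law p M D π n) :=
  integrable_finsetSum _ fun t _ =>
    Integrable.of_bound ((measurable_noise p D).comp (measurable_pi_apply t)).aestronglyMeasurable 1
      (Filter.Eventually.of_forall fun h => norm_noise_le p D (h t))

lemma integral_sum_noise (n : ℕ) :
    ∫ h, ∑ t, noise p D (h t) ∂(law p M D π n) = 0 := by
  induction n with
  | zero => simp
  | succ n ih =>
    have hm : Measurable fun h : History K (n + 1) => ∑ t, noise p D (h t) :=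
      Finset.measurable_sum _ fun t _ => (measurable_noise p D).comp (measurable_pi_apply t)
    rw [law, integral_map measurable_snoc.aemeasurable hm.aestronglyMeasurable]
    simp only [Fin.sum_univ_castSucc, Fin.snoc_castSucc, Fin.snoc_last]
    have h1 : Integrable (fun x : History K n × (Fin K × I) => ∑ t, noise p D (x.1 t))
        (law p M D π n ⊗ₘ step p M D π n) := by
      have h0 := integrable_sum_noise p M D π n
      rw [← Measure.fst_compProd (law p M D π n) (step p M D π n)] at h0
      exact h0.comp_measurable measurable_fst
    have h2 : Integrable (fun x : History K n × (Fin K × I) => noise p D x.2)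
        (law p M D π n ⊗ₘ step p M D π n) :=
      Integrable.of_bound ((measurable_noise p D).comp measurable_snd).aestronglyMeasurable 1
        (Filter.Eventually.of_forall fun x => norm_noise_le p D x.2)
    rw [integral_add h1 h2, Measure.integral_compProd h1, Measure.integral_compProd h2]
    simp [integral_noise_step, ih]

/-- The regret along one history with respect to the fixed price `b`, up to mean-zero
noise: the gaps in expected reward of the offered prices, plus the refunds paid. -/
def pathCost (b : Fin K) {n : ℕ} (h : History K n) : ℝ :=
  ∑ t, (p b * meanDemand D b - p (h t).1 * meanDemand D (h t).1) +
    ∑ t, ((p (h t).1 : ℝ) - lowestPrice p h t M) * (h t).2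

lemma lowestPrice_le {n : ℕ} (h : History K n) (s w : Fin n) (m : ℕ) (h1 : s ≤ w)
    (h2 : (w : ℕ) ≤ s + m) : lowestPrice p h s m ≤ p (h w).1 :=
  Finset.inf'_le _ (by simp [h1, h2])

lemma pathCost_eq (b : Fin K) {n : ℕ} (h : History K n) :
    pathCost p M D b h =
      n * (p b * meanDemand D b) - revenue p M h + ∑ t, noise p D (h t) := by
  simp only [pathCost, revenue, noise, mul_sub, sub_mul, Finset.sum_sub_distrib,
    Finset.sum_const, Finset.card_univ, Fintype.card_fin, nsmul_eq_mul]
  ring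

/-- A lower bound for the path cost on an event bounds the regret. -/
lemma mul_law_le_regret (b : Fin K) (n : ℕ) {E : Set (History K n)} (hE : MeasurableSet E) {κ : ℝ}
    (h0 : ∀ᵐ h ∂(law p M D π n), E.indicator (fun _ => κ) h ≤ pathCost p M D b h) :
    κ * (law p M D π n).real E ≤ regret n M p D π := by
  have hi : Integrable (pathCost p M D b) (law p M D π n) := by
    have := ((integrable_const (μ := law p M D π n) ((n : ℝ) * (p b * meanDemand D b))).sub
      (integrable_revenue p M D π n)).add (integrable_sum_noise p M D π n)
    exact this.congr (Filter.Eventually.of_forall fun h => (pathCost_eq p M D b h).symm)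
  have h1 : ∫ h, pathCost p M D b h ∂(law p M D π n) =
      n * (p b * meanDemand D b) - ∫ h, revenue p M h ∂(law p M D π n) := by
    simp_rw [pathCost_eq]
    have h2 := integral_sub (integrable_const ((n : ℝ) * (p b * meanDemand D b)))
      (integrable_revenue p M D π n)
    refine (integral_add ((integrable_const _).sub (integrable_revenue p M D π n))
      (integrable_sum_noise p M D π n)).trans ?_
    rw [integral_sum_noise, add_zero]
    refine h2.trans ?_
    simp
  have h2 := integral_mono_ae ((integrable_const κ).indicator hE) hi h0
  rw [integral_indicator_const _ hE, h1, smul_eq_mul] at h2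
  have h3 : (p b : ℝ) * meanDemand D b ≤ ⨆ k : Fin K, (p k : ℝ) * meanDemand D k :=
    le_ciSup (f := fun k : Fin K => (p k : ℝ) * meanDemand D k) (Set.finite_range _).bddAbove b
  have h4 := mul_le_mul_of_nonneg_left h3 (Nat.cast_nonneg (α := ℝ) n)
  unfold regret
  linarith

/-! ### The hard demand environments -/

/-- The price menu `1 / 2 < 3 / 4`. -/
def menu : Fin 2 → I := ![⟨1 / 2, by norm_num, by norm_num⟩, ⟨3 / 4, by norm_num, by norm_num⟩]

@[simp] lemma menu_zero : (menu 0 : ℝ) = 1 / 2 := rfl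

@[simp] lemma menu_one : (menu 1 : ℝ) = 3 / 4 := rfl

/-- The demand `1 / 4` or `3 / 4`, with probabilities tilted by `y`; the mean is `1 / 2 + y / 8`. -/
def tilted (y : ℝ) (hy : y ∈ Set.Icc (-1 : ℝ) 1) : ProbabilityMeasure I :=
  ⟨ENNReal.ofReal ((1 - y / 2) / 2) • Measure.dirac ⟨1 / 4, by norm_num, by norm_num⟩ +
    ENNReal.ofReal ((1 + y / 2) / 2) • Measure.dirac ⟨3 / 4, by norm_num, by norm_num⟩, ⟨by
      simp only [Measure.coe_add, Measure.coe_smul, Pi.add_apply, Pi.smul_apply, measure_univ,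
        smul_eq_mul, mul_one]
      rw [← ENNReal.ofReal_add (by linarith [hy.2]) (by linarith [hy.1])]
      norm_num [← add_div]⟩⟩

lemma coe_tilted (y : ℝ) (hy : y ∈ Set.Icc (-1 : ℝ) 1) : (tilted y hy : Measure I) =
    ENNReal.ofReal ((1 - y / 2) / 2) • Measure.dirac ⟨1 / 4, by norm_num, by norm_num⟩ +
    ENNReal.ofReal ((1 + y / 2) / 2) • Measure.dirac ⟨3 / 4, by norm_num, by norm_num⟩ := rfl

/-- The constant demand `3 / 4 + 3 z / 32`. -/
def constant (z : ℝ) (hz : z ∈ Set.Icc (0 : ℝ) 1) : ProbabilityMeasure I :=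
  ⟨Measure.dirac ⟨3 / 4 + 3 * z / 32, ⟨by linarith [hz.1], by linarith [hz.2]⟩⟩, inferInstance⟩

lemma coe_constant (z : ℝ) (hz : z ∈ Set.Icc (0 : ℝ) 1) : (constant z hz : Measure I) =
    Measure.dirac ⟨3 / 4 + 3 * z / 32, ⟨by linarith [hz.1], by linarith [hz.2]⟩⟩ := rfl

/-- The demand environment: at the low price the demand is the constant `3 / 4 + 3 z / 32`, so that
its expected reward is `3 / 8 + 3 z / 64`; at the high price it is tilted by `y`, so that its
expected reward is `3 / 8 + 3 y / 32`. -/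
def environment (z : ℝ) (hz : z ∈ Set.Icc (0 : ℝ) 1) (y : ℝ) (hy : y ∈ Set.Icc (-1 : ℝ) 1) :
    Fin 2 → ProbabilityMeasure I :=
  ![constant z hz, tilted y hy]

lemma environment_zero {z : ℝ} (hz : z ∈ Set.Icc (0 : ℝ) 1) {y : ℝ}
    (hy : y ∈ Set.Icc (-1 : ℝ) 1) : environment z hz y hy 0 = constant z hz := rfl

lemma environment_one {z : ℝ} (hz : z ∈ Set.Icc (0 : ℝ) 1) {y : ℝ}
    (hy : y ∈ Set.Icc (-1 : ℝ) 1) : environment z hz y hy 1 = tilted y hy := rfl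

/-- The density of `environment z y` relative to `environment z 0`. -/
def tilt (y : ℝ) (k : Fin 2) (d : I) : ENNReal :=
  if k = 0 then 1 else ENNReal.ofReal (1 + y * (2 * d - 1))

lemma measurable_tilt (y : ℝ) (k : Fin 2) : Measurable (tilt y k) := by
  unfold tilt
  split_ifs <;> fun_prop

lemma environment_eq_withDensity {z : ℝ} (hz : z ∈ Set.Icc (0 : ℝ) 1) {y : ℝ}
    (hy : y ∈ Set.Icc (-1 : ℝ) 1) (h0 : (0 : ℝ) ∈ Set.Icc (-1 : ℝ) 1) (k : Fin 2) :
    (environment z hz y hy k : Measure I) =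
      (environment z hz 0 h0 k : Measure I).withDensity (tilt y k) := by
  refine Measure.ext_of_lintegral _ fun f hf => ?_
  rw [lintegral_withDensity_eq_lintegral_mul _ (measurable_tilt y k) hf]
  fin_cases k
  · simp [environment_zero, tilt]
  · simp only [Fin.mk_one, environment_one, coe_tilted,
      lintegral_add_measure, lintegral_smul_measure, lintegral_dirac, Pi.mul_apply, tilt,
      smul_eq_mul, one_ne_zero, if_false, ← mul_assoc]
    rw [← ENNReal.ofReal_mul (by norm_num), ← ENNReal.ofReal_mul (by norm_num)]
    congr 4 <;> ring

lemma meanDemand_environment_zero {z : ℝ} (hz : z ∈ Set.Icc (0 : ℝ) 1) {y : ℝ}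
    (hy : y ∈ Set.Icc (-1 : ℝ) 1) :
    meanDemand (environment z hz y hy) 0 = 3 / 4 + 3 * z / 32 := by
  simp [meanDemand, environment_zero, coe_constant]

lemma meanDemand_environment_one {z : ℝ} (hz : z ∈ Set.Icc (0 : ℝ) 1) {y : ℝ}
    (hy : y ∈ Set.Icc (-1 : ℝ) 1) :
    meanDemand (environment z hz y hy) 1 = 1 / 2 + y / 8 := by
  simp only [meanDemand, environment_one, coe_tilted]
  rw [integral_add_measure ((integrable_dirac (by simp)).smul_measure ENNReal.ofReal_ne_top)
    ((integrable_dirac (by simp)).smul_measure ENNReal.ofReal_ne_top),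
    integral_smul_measure, integral_smul_measure, integral_dirac, integral_dirac,
    ENNReal.toReal_ofReal (by linarith [hy.2]), ENNReal.toReal_ofReal (by linarith [hy.1])]
  simp only [smul_eq_mul]
  ring

lemma ae_environment {z : ℝ} (hz : z ∈ Set.Icc (0 : ℝ) 1) {y : ℝ}
    (hy : y ∈ Set.Icc (-1 : ℝ) 1) (k : Fin 2) :
    ∀ᵐ d : I ∂(environment z hz y hy k : Measure I), (1 / 4 : ℝ) ≤ d := by
  have hm : MeasurableSet {d : I | (1 / 4 : ℝ) ≤ d} :=
    measurableSet_le measurable_const measurable_subtype_coe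
  fin_cases k
  · simp only [Fin.zero_eta, environment_zero, coe_constant]
    refine (ae_dirac_iff hm).2 ?_
    change (1 / 4 : ℝ) ≤ 3 / 4 + 3 * z / 32
    linarith [hz.1]
  · simp only [Fin.mk_one, environment_one, coe_tilted,
      ae_add_measure_iff]
    exact ⟨Measure.ae_smul_measure ((ae_dirac_iff hm).2 (by norm_num)) _,
      Measure.ae_smul_measure ((ae_dirac_iff hm).2 (by norm_num)) _⟩

/-! ### Trials of the high price and refunds -/

/-- How often price `k` is offered. -/
def offers {n : ℕ} (k : Fin 2) (h : History 2 n) : ℕ :=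
  (Finset.univ.filter fun t => (h t).1 = k).card

lemma measurable_offers {n : ℕ} (k : Fin 2) : Measurable (offers k : History 2 n → ℕ) :=
  (measurable_of_finite fun i : Fin n → Fin 2 => (Finset.univ.filter fun t => i t = k).card).comp
    (measurable_pi_lambda _ fun t => measurable_fst.comp (measurable_pi_apply t))

lemma offers_zero_add_offers_one {n : ℕ} (h : History 2 n) : offers 0 h + offers 1 h = n := by
  have := Finset.card_filter_add_card_filter_not (s := Finset.univ) (fun t : Fin n => (h t).1 = 0)
  rw [Finset.card_univ, Fintype.card_fin] at this
  have h1 : offers 1 h = (Finset.univ.filter fun t : Fin n => ¬ (h t).1 = 0).card :=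
    congrArg Finset.card (Finset.filter_congr fun t _ => by omega)
  rw [h1]
  exact this

/-- The steps at which the high price is offered but a refund is due. -/
def refunded {n : ℕ} (M : ℕ) (h : History 2 n) : Finset (Fin n) :=
  Finset.univ.filter fun t => (h t).1 = 1 ∧ ∃ w, t < w ∧ (w : ℕ) ≤ t + M ∧ (h w).1 = 0

/-- Unless the seller stays with the high price after the first `n` steps, refunds are due either
at each high-price step among the first `n`, or on a full window of `M` steps. -/
lemma min_le_card_refunded {n k : ℕ} (M : ℕ) (h : History 2 (n + k))
    (hw : ∃ w : Fin (n + k), n ≤ (w : ℕ) ∧ (h w).1 = 0) :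
    min (offers 1 (initial h)) M ≤ (refunded M h).card := by
  by_cases hall : ∀ t : Fin n, (h (Fin.castAdd k t)).1 = 1 → Fin.castAdd k t ∈ refunded M h
  · refine (min_le_left _ _).trans ?_
    unfold offers
    rw [← Finset.card_map (Fin.castAddEmb k)]
    refine Finset.card_le_card fun s hs => ?_
    obtain ⟨t, ht, rfl⟩ := Finset.mem_map.1 hs
    exact hall t (Finset.mem_filter.1 ht).2
  · refine (min_le_right _ _).trans ?_
    push Not at hall
    obtain ⟨t, ht1, ht2⟩ := hall
    obtain ⟨w0, hw0, hw1⟩ := hw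
    have hne : (Finset.univ.filter fun w : Fin (n + k) =>
        Fin.castAdd k t < w ∧ (h w).1 = 0).Nonempty :=
      ⟨w0, by simp only [Finset.mem_filter, Finset.mem_univ, true_and, Fin.lt_def, hw1, and_true,
        Fin.val_castAdd]; omega⟩
    -- the first low-price step `w` after `t`, which comes more than `M` steps later
    obtain ⟨w, hwm, hmin⟩ := Finset.exists_min_image _ id hne
    simp only [Finset.mem_filter, Finset.mem_univ, true_and, id] at hwm hmin
    have hfar : (t : ℕ) + M < w := by
      by_contra hc
      exact ht2 (by
        simp only [refunded, Finset.mem_filter, Finset.mem_univ, true_and]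
        exact ⟨ht1, w, hwm.1, by simpa using hc, hwm.2⟩)
    have hcard : (Finset.Ico (⟨w - M, by omega⟩ : Fin (n + k)) w).card = M := by
      rw [Fin.card_Ico]; simp only; omega
    rw [← hcard]
    refine Finset.card_le_card fun s hs => ?_
    simp only [Finset.mem_Ico, Fin.le_def, Fin.lt_def] at hs
    simp only [refunded, Finset.mem_filter, Finset.mem_univ, true_and]
    refine ⟨?_, w, hs.2, by omega, hwm.2⟩
    by_contra hs1
    have := hmin s ⟨by rw [Fin.lt_def, Fin.val_castAdd]; omega, by omega⟩
    rw [Fin.le_def] at this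
    omega

lemma le_offers_of_forall_ge {n k : ℕ} (h : History 2 (n + k))
    (hw : ∀ w : Fin (n + k), n ≤ (w : ℕ) → (h w).1 = 1) : k ≤ offers 1 h := by
  have : (Finset.univ.map (Fin.natAddEmb n : Fin k ↪ Fin (n + k))).card = k := by simp
  unfold offers
  refine this.symm.le.trans (Finset.card_le_card fun s hs => ?_)
  obtain ⟨t, -, rfl⟩ := Finset.mem_map.1 hs
  simpa using hw (Fin.natAdd n t) (by simp)

lemma offers_initial_le {n k : ℕ} (j : Fin 2) (h : History 2 (n + k)) :
    offers j (initial h) ≤ offers j h := by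
  unfold offers
  rw [← Finset.card_map (Fin.castAddEmb k)]
  refine Finset.card_le_card fun s hs => ?_
  obtain ⟨t, ht, rfl⟩ := Finset.mem_map.1 hs
  exact Finset.mem_filter.2 ⟨Finset.mem_univ _, (Finset.mem_filter.1 ht).2⟩

/-! ### Indistinguishability -/

lemma le_likelihood_tilt_mul {y : ℝ} (hy : y ∈ Set.Icc (0 : ℝ) 1) {n : ℕ} (h : History 2 n) :
    ENNReal.ofReal ((1 - y ^ 2) ^ offers 1 h) ≤
      likelihood (tilt y) h * likelihood (tilt (-y)) h := by
  have hy2 : 0 ≤ 1 - y ^ 2 := by nlinarith [hy.1, hy.2]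
  rw [likelihood, likelihood, ← Finset.prod_mul_distrib, offers, ENNReal.ofReal_pow hy2,
    ← Finset.prod_const, Finset.prod_filter]
  refine Finset.prod_le_prod' fun t _ => ?_
  split_ifs with ht
  · have hd := (h t).2.2
    simp only [tilt, ht, one_ne_zero, if_false]
    rw [← ENNReal.ofReal_mul (by nlinarith [hy.1, hy.2, hd.1, hd.2])]
    refine ENNReal.ofReal_le_ofReal ?_
    have : 0 ≤ y ^ 2 * ((h t).2 * (1 - (h t).2) : ℝ) :=
      mul_nonneg (sq_nonneg y) (mul_nonneg hd.1 (by linarith [hd.2]))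
    nlinarith
  · have : (h t).1 = 0 := by omega
    simp [tilt, this]

lemma one_le_of_half_le_mul {a b : ENNReal} (h : 1 / 2 ≤ a * b) : 1 ≤ 2 * a + b / 4 := by
  by_cases ha : a = ⊤
  · simp [ha]
  by_cases hb : b = ⊤
  · simp [hb, ENNReal.top_div]
  lift a to NNReal using ha
  lift b to NNReal using hb
  have h' : (1 / 2 : ℝ) ≤ a * b := by
    have := ENNReal.toReal_mono (ENNReal.mul_ne_top ENNReal.coe_ne_top ENNReal.coe_ne_top) h
    simpa using this
  have : (1 : ℝ) ≤ 2 * a + b / 4 := by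
    nlinarith [sq_nonneg (2 * (a : ℝ) - b / 4), a.2, b.2]
  have h2 : (1 : NNReal) ≤ 2 * a + b / 4 := by exact_mod_cast this
  have h3 : ((1 : NNReal) : ENNReal) ≤ ((2 * a + b / 4 : NNReal) : ENNReal) := by exact_mod_cast h2
  simpa [ENNReal.coe_div] using h3

/-- With few high-price steps among the first `n`, the environments tilted by `0` and `y` cannot be
told apart. The likelihood ratios for `y` and `-y` have a product bounded below on this event, so
that one of the two is not small. -/
lemma law_few_offers_le (M : ℕ) (π : Policy 2) {z : ℝ} (hz : z ∈ Set.Icc (0 : ℝ) 1) {y : ℝ}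
    (hy : y ∈ Set.Icc (0 : ℝ) 1) (hy1 : y ∈ Set.Icc (-1 : ℝ) 1)
    (h0 : (0 : ℝ) ∈ Set.Icc (-1 : ℝ) 1)
    {m : ℝ} (hm : m * y ^ 2 ≤ 1 / 2) (n : ℕ) :
    (law menu M (environment z hz 0 h0) π n).real {h | (offers 1 h : ℝ) < m} ≤
      2 * (law menu M (environment z hz y hy1) π n).real {h | (offers 1 h : ℝ) < m} + 1 / 4 := by
  have hy2 : -y ∈ Set.Icc (-1 : ℝ) 1 := ⟨by linarith [hy.2], by linarith [hy.1]⟩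
  set E : Set (History 2 n) := {h | (offers 1 h : ℝ) < m} with hE
  have hEm : MeasurableSet E :=
    measurableSet_lt ((measurable_of_countable (fun j : ℕ => (j : ℝ))).comp (measurable_offers 1))
      measurable_const
  have hone : Measurable (E.indicator (1 : History 2 n → ENNReal)) := measurable_one.indicator hEm
  have hlaw : ∀ {x : ℝ} (hx : x ∈ Set.Icc (-1 : ℝ) 1),
      law menu M (environment z hz x hx) π n E =
      ∫⁻ h, likelihood (tilt x) h * E.indicator 1 h ∂(law menu M (environment z hz 0 h0) π n) := by
    intro x hx
    rw [← lintegral_indicator_one hEm]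
    exact lintegral_law_eq_likelihood _ _ _ _ (measurable_tilt x)
      (environment_eq_withDensity hz hx h0) n hone
  have hle : law menu M (environment z hz 0 h0) π n E ≤
      2 * law menu M (environment z hz y hy1) π n E +
        law menu M (environment z hz (-y) hy2) π n E / 4 := by
    have e1 : Measurable fun h => likelihood (tilt y) h * E.indicator 1 h :=
      (measurable_likelihood (measurable_tilt y) n).mul hone
    have e2 : Measurable fun h => likelihood (tilt (-y)) h * E.indicator 1 h :=
      (measurable_likelihood (measurable_tilt (-y)) n).mul hone
    rw [hlaw hy1, hlaw hy2, ← lintegral_indicator_one hEm, ENNReal.div_eq_inv_mul,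
      ← lintegral_const_mul _ e1, ← lintegral_const_mul _ e2,
      ← lintegral_add_left (e1.const_mul 2)]
    refine lintegral_mono fun h => ?_
    by_cases hh : h ∈ E
    · have hb : (1 / 2 : ENNReal) ≤ likelihood (tilt y) h * likelihood (tilt (-y)) h := by
        refine le_trans ?_ (le_likelihood_tilt_mul hy h)
        have h1 := one_add_mul_le_pow (a := -y ^ 2) (by nlinarith [hy.1, hy.2]) (offers 1 h)
        have h2 : (offers 1 h : ℝ) * y ^ 2 ≤ m * y ^ 2 :=
          mul_le_mul_of_nonneg_right (le_of_lt hh) (sq_nonneg y)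
        have h3 : (1 / 2 : ℝ) ≤ (1 - y ^ 2) ^ offers 1 h := by
          rw [sub_eq_add_neg]; linarith
        refine le_trans (le_of_eq ?_) (ENNReal.ofReal_le_ofReal h3)
        rw [ENNReal.ofReal_div_of_pos (by norm_num)]
        simp
      have := one_le_of_half_le_mul hb
      rw [ENNReal.div_eq_inv_mul] at this
      simpa [hh] using this
    · simp [hh]
  have hle1 : law menu M (environment z hz (-y) hy2) π n E ≤ 1 := prob_le_one
  have hle' : law menu M (environment z hz 0 h0) π n E ≤
      2 * law menu M (environment z hz y hy1) π n E + 1 / 4 :=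
    hle.trans (add_le_add_right (ENNReal.div_le_div_right hle1 4) _)
  have hfin : (2 * law menu M (environment z hz y hy1) π n E) ≠ ⊤ :=
    ENNReal.mul_ne_top (by simp) (measure_ne_top _ _)
  have := ENNReal.toReal_mono (ENNReal.add_ne_top.2 ⟨hfin, by simp⟩) hle'
  rw [ENNReal.toReal_add hfin (by simp)] at this
  simpa [Measure.real] using this

/-! ### The regret lower bounds -/

/-- Where the low price is the better one, the cost counts the high-price steps and the refunds. -/
lemma le_pathCost_low {y : ℝ} (hy : y ∈ Set.Icc (0 : ℝ) 1) (h0 : (0 : ℝ) ∈ Set.Icc (-1 : ℝ) 1)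
    (M : ℕ) {n : ℕ} (h : History 2 n) (hd : ∀ t, (1 / 4 : ℝ) ≤ (h t).2) :
    3 * y / 64 * offers 1 h + (refunded M h).card / 16 ≤
      pathCost menu M (environment y hy 0 h0) 0 h := by
  unfold pathCost
  refine add_le_add ?_ ?_
  · rw [offers, ← Finset.sum_boole, Finset.mul_sum]
    refine Finset.sum_le_sum fun t _ => ?_
    obtain ht | ht : (h t).1 = 0 ∨ (h t).1 = 1 := by omega
    · simp [ht]
    · simp only [ht, meanDemand_environment_zero, meanDemand_environment_one, menu_zero, menu_one,
        if_true]
      linarith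
  · rw [refunded, ← Finset.sum_boole, Finset.sum_div]
    refine Finset.sum_le_sum fun t _ => ?_
    split_ifs with ht
    · obtain ⟨ht1, w, hw1, hw2, hw3⟩ := ht
      have := lowestPrice_le menu h t w M hw1.le hw2
      rw [hw3, menu_zero] at this
      rw [ht1, menu_one]
      nlinarith [hd t]
    · rw [zero_div]
      exact mul_nonneg (sub_nonneg.2 (lowestPrice_le menu h t t M le_rfl (by omega))) (h t).2.2.1

/-- Where the high price is the better one, the cost counts the low-price steps. -/
lemma le_pathCost_high {y : ℝ} (hy : y ∈ Set.Icc (0 : ℝ) 1) (hy1 : y ∈ Set.Icc (-1 : ℝ) 1)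
    (M : ℕ) {n : ℕ} (h : History 2 n) :
    3 * y / 64 * offers 0 h ≤ pathCost menu M (environment y hy y hy1) 1 h := by
  unfold pathCost
  refine (add_zero _).symm.le.trans (add_le_add ?_ (Finset.sum_nonneg fun t _ => ?_))
  · rw [offers, ← Finset.sum_boole, Finset.mul_sum]
    refine Finset.sum_le_sum fun t _ => ?_
    obtain ht | ht : (h t).1 = 0 ∨ (h t).1 = 1 := by omega
    · simp only [ht, meanDemand_environment_zero, meanDemand_environment_one, menu_zero, menu_one,
        if_true]
      linarith
    · simp [ht]
  · exact mul_nonneg (sub_nonneg.2 (lowestPrice_le menu h t t M le_rfl (by omega))) (h t).2.2.1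

/-- A seller who often tries the high price early pays `κ` where the low price is better; one who
does not pays `κ` where the high price is better, and cannot tell which case it is. -/
lemma exists_le_regret (M n k : ℕ) (π : Policy 2) {y m κ : ℝ} (hy : y ∈ Set.Icc (0 : ℝ) 1)
    (hm : m * y ^ 2 ≤ 1 / 2) (hκ : 0 ≤ κ)
    (hlow : ∀ h : History 2 (n + k), m ≤ offers 1 (initial h) →
      κ ≤ 3 * y / 64 * offers 1 h + (refunded M h).card / 16)
    (hhigh : ∀ h : History 2 (n + k), offers 1 (initial h) < m → κ ≤ 3 * y / 64 * offers 0 h) :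
    ∃ D : Fin 2 → ProbabilityMeasure I, κ / 8 ≤ regret (n + k) M menu D π := by
  have h0 : (0 : ℝ) ∈ Set.Icc (-1 : ℝ) 1 := by norm_num
  have hy1 : y ∈ Set.Icc (-1 : ℝ) 1 := ⟨by linarith [hy.1], hy.2⟩
  have hy3 : 0 ≤ 3 * y / 64 := by linarith [hy.1]
  set E : Set (History 2 n) := {h | (offers 1 h : ℝ) < m} with hE
  have hEm : MeasurableSet E :=
    measurableSet_lt ((measurable_of_countable (fun j : ℕ => (j : ℝ))).comp (measurable_offers 1))
      measurable_const
  set A := environment y hy 0 h0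
  set B := environment y hy y hy1
  have hA : κ * (law menu M A π (n + k)).real (initial ⁻¹' Eᶜ) ≤ regret (n + k) M menu A π := by
    refine mul_law_le_regret menu M A π 0 _ (measurable_initial hEm.compl) ?_
    filter_upwards [ae_law_forall menu M A π (q := fun d : I => (1 / 4 : ℝ) ≤ d)
      (measurableSet_le measurable_const measurable_subtype_coe) (ae_environment hy h0) (n + k)]
      with h hd
    have hc := le_pathCost_low hy h0 M h hd
    by_cases hh : h ∈ (initial ⁻¹' Eᶜ : Set (History 2 (n + k)))
    · rw [Set.indicator_of_mem hh]
      exact (hlow h (not_lt.1 hh)).trans hc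
    · rw [Set.indicator_of_notMem hh]
      exact (by positivity : (0 : ℝ) ≤ _).trans hc
  have hB : κ * (law menu M B π (n + k)).real (initial ⁻¹' E) ≤ regret (n + k) M menu B π := by
    refine mul_law_le_regret menu M B π 1 _ (measurable_initial hEm)
      (Filter.Eventually.of_forall fun h => ?_)
    have hc := le_pathCost_high hy hy1 M h
    by_cases hh : h ∈ (initial ⁻¹' E : Set (History 2 (n + k)))
    · rw [Set.indicator_of_mem hh]
      exact (hhigh h hh).trans hc
    · rw [Set.indicator_of_notMem hh]
      exact (by positivity : (0 : ℝ) ≤ _).trans hc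
  rw [← map_measureReal_apply measurable_initial hEm.compl, map_initial_law,
    probReal_compl_eq_one_sub hEm] at hA
  rw [← map_measureReal_apply measurable_initial hEm, map_initial_law] at hB
  have hAB := law_few_offers_le M π hy hy hy1 h0 hm n
  rw [← hE] at hAB
  by_cases hhalf : (law menu M A π n).real E ≤ 1 / 2
  · exact ⟨A, by nlinarith⟩
  · exact ⟨B, by nlinarith⟩

/-- The part of the regret that is due to learning alone: the two environments differ by a tilt of
order `T ^ (-1 / 2)`. -/
lemma exists_sqrt_le_regret (M : ℕ) {T : ℕ} (hT : 2 ≤ T) (π : Policy 2) :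
    ∃ D : Fin 2 → ProbabilityMeasure I, 3 / 2048 * √T ≤ regret T M menu D π := by
  have hT0 : (0 : ℝ) < T := by positivity
  have hs : √(T : ℝ) * √T = T := Real.mul_self_sqrt hT0.le
  have hs1 : 1 ≤ √(T : ℝ) := Real.one_le_sqrt.2 (by exact_mod_cast (by omega : 1 ≤ T))
  have hs0 : 0 < √(T : ℝ) := by linarith
  have hy : (√(T : ℝ))⁻¹ ∈ Set.Icc (0 : ℝ) 1 := ⟨by positivity, inv_le_one_of_one_le₀ hs1⟩
  have hyT : (√(T : ℝ))⁻¹ * T = √T := by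
    rw [inv_mul_eq_iff_eq_mul₀ hs0.ne', hs]
  have hy2 : (T : ℝ) * (√(T : ℝ))⁻¹ ^ 2 = 1 := by
    rw [inv_pow, pow_two, hs, mul_inv_cancel₀ hT0.ne']
  -- refunds play no part here, and every step counts as early
  obtain ⟨D, hD⟩ := exists_le_regret M T 0 π (m := T / 4) (κ := 3 / 256 * √T) hy
    (by linarith) (by positivity)
    (fun h hh => by
      have h1 : (offers 1 (initial h) : ℝ) ≤ offers 1 h := by exact_mod_cast offers_initial_le 1 h
      have h2 : (√(T : ℝ))⁻¹ * (T / 4) ≤ (√(T : ℝ))⁻¹ * offers 1 h :=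
        mul_le_mul_of_nonneg_left (hh.trans h1) hy.1
      have h3 : (0 : ℝ) ≤ (refunded M h).card := by positivity
      linarith)
    (fun h hh => by
      have h1 : (offers 0 (initial h) : ℝ) ≤ offers 0 h := by exact_mod_cast offers_initial_le 0 h
      have h2 : (offers 0 (initial h) : ℝ) + offers 1 (initial h) = T := by
        exact_mod_cast offers_zero_add_offers_one (initial h)
      have h3 : (√(T : ℝ))⁻¹ * (T / 4) ≤ (√(T : ℝ))⁻¹ * offers 0 h :=
        mul_le_mul_of_nonneg_left (by linarith) hy.1
      linarith)
  exact ⟨D, by rw [add_zero] at hD; linarith⟩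

/-- The part of the regret that is due to refunds: the tilt is of order `T ^ (-1 / 3)`, too small to
be detected by fewer than `T ^ (2 / 3)` trials of the high price, each of which is refunded unless
the seller trusts the high price for `M` more steps. -/
lemma exists_min_le_regret {M T : ℕ} (hT : 2 ≤ T) (hMT : M ≤ T) (π : Policy 2) :
    ∃ D : Fin 2 → ProbabilityMeasure I,
      3 / 2048 * min (M : ℝ) ((T : ℝ) ^ (2 / 3 : ℝ)) ≤ regret T M menu D π := by
  have hT0 : (0 : ℝ) < T := by positivity
  have hT1 : (1 : ℝ) ≤ T := by exact_mod_cast (by omega : 1 ≤ T)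
  set y : ℝ := (T : ℝ) ^ (-(1 / 3) : ℝ) with hydef
  set μ : ℝ := min (M : ℝ) ((T : ℝ) ^ (2 / 3 : ℝ)) with hμ
  have hy : y ∈ Set.Icc (0 : ℝ) 1 :=
    ⟨by positivity, Real.rpow_le_one_of_one_le_of_nonpos hT1 (by norm_num)⟩
  have hyT : y * T = (T : ℝ) ^ (2 / 3 : ℝ) := by
    rw [hydef, ← Real.rpow_add_one hT0.ne']; norm_num
  have hy2 : (T : ℝ) ^ (2 / 3 : ℝ) * y ^ 2 = 1 := by
    rw [hydef, ← Real.rpow_natCast, ← Real.rpow_mul hT0.le, ← Real.rpow_add hT0]; norm_num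
  have hμ0 : 0 ≤ μ := le_min (by positivity) (by positivity)
  have hμM : μ ≤ M := min_le_left _ _
  have hμT : μ ≤ (T : ℝ) ^ (2 / 3 : ℝ) := min_le_right _ _
  have hMT' : (M : ℝ) ≤ T := by exact_mod_cast hMT
  have hμy : μ * y ^ 2 ≤ 1 := hy2 ▸ mul_le_mul_of_nonneg_right hμT (sq_nonneg y)
  -- the first half counts the early trials; the second half is long enough that staying with the
  -- high price to the end costs `κ`
  obtain ⟨n, k, hnk, hn, hk⟩ : ∃ n k, T = n + k ∧ T ≤ 2 * n ∧ T ≤ 3 * k :=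
    ⟨T - T / 2, T / 2, by omega, by omega, by omega⟩
  have hn' : (T : ℝ) ≤ 2 * n := by exact_mod_cast hn
  have hk' : (T : ℝ) ≤ 3 * k := by exact_mod_cast hk
  obtain ⟨D, hD⟩ := exists_le_regret M n k π (m := μ / 4) (κ := 3 / 256 * μ) hy
    (by linarith) (by positivity)
    (fun h hh => by
      by_cases hw : ∃ w : Fin (n + k), n ≤ (w : ℕ) ∧ (h w).1 = 0
      · have h1 : ((min (offers 1 (initial h)) M : ℕ) : ℝ) ≤ (refunded M h).card := by
          exact_mod_cast min_le_card_refunded M h hw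
        rw [Nat.cast_min] at h1
        have h2 := (le_min hh (by linarith : μ / 4 ≤ M)).trans h1
        have h3 : 0 ≤ 3 * y / 64 * offers 1 h := mul_nonneg (by linarith [hy.1]) (by positivity)
        linarith
      · push Not at hw
        have h1 : (k : ℝ) ≤ offers 1 h := by
          exact_mod_cast le_offers_of_forall_ge h fun w hwn => by
            have := hw w hwn
            omega
        have h2 : y * (T / 3) ≤ y * offers 1 h := mul_le_mul_of_nonneg_left (by linarith) hy.1
        have h3 : (0 : ℝ) ≤ (refunded M h).card := by positivity
        linarith)
    (fun h hh => by
      have h1 : (offers 0 (initial h) : ℝ) ≤ offers 0 h := by exact_mod_cast offers_initial_le 0 h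
      have h2 : (offers 0 (initial h) : ℝ) + offers 1 (initial h) = n := by
        exact_mod_cast offers_zero_add_offers_one (initial h)
      have h3 : y * (T / 4) ≤ y * offers 0 h := mul_le_mul_of_nonneg_left (by linarith) hy.1
      linarith)
  exact ⟨D, by rw [hnk]; linarith⟩

end PriceProtection

end

/-- There is a universal constant `c > 0` such that for all integers `T ≥ M ≥ 2` and every
non-anticipatory policy `π` (which may use the price menu `p`, as well as `T` and `M`) there are
prices `p 0 < p 1` in `[0, 1]` and demand distributions on `[0, 1]` for which the regret is at least
`c * (√T + min {M, T ^ (2/3)})`. -/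
theorem mainTheorem2 :
    ∃ c : ℝ, 0 < c ∧ ∀ T M : ℕ, 2 ≤ M → M ≤ T →
      ∀ π : (Fin 2 → unitInterval) → PriceProtection.Policy 2,
        ∃ p : Fin 2 → unitInterval, p 0 < p 1 ∧
          ∃ D : Fin 2 → MeasureTheory.ProbabilityMeasure unitInterval,
            c * (Real.sqrt T + min (M : ℝ) ((T : ℝ) ^ (2 / 3 : ℝ))) ≤
              PriceProtection.regret T M p D (π p) := by
  refine ⟨3 / 4096, by norm_num, fun T M hM hMT π => ⟨PriceProtection.menu, ?_, ?_⟩⟩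
  · rw [← Subtype.coe_lt_coe, PriceProtection.menu_zero, PriceProtection.menu_one]
    norm_num
  · rcases le_total (min (M : ℝ) ((T : ℝ) ^ (2 / 3 : ℝ))) (Real.sqrt T) with hle | hle
    · obtain ⟨D, hD⟩ := PriceProtection.exists_sqrt_le_regret M (hM.trans hMT)
        (π PriceProtection.menu)
      exact ⟨D, by linarith⟩
    · obtain ⟨D, hD⟩ := PriceProtection.exists_min_le_regret (hM.trans hMT) hMT
        (π PriceProtection.menu)
      exact ⟨D, by linarith⟩
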